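/- Let $M$ be a smooth ($C^\infty$, Hausdorff, second countable) manifold of dimension $m$, $U\subset\mathbb R^k$ open, $X\colon M\times U\to TM$ a smooth vector field along the projection $M\times U\to M$, and $F\colon M\times U\to\mathbb R$ a smooth cost function. Let $\Omega$ be the pull-back to $T^*M\times U$ of the canonical 2-form $\sum_i dx^i\wedge dp_i$ of $T^*M$, and let $$H(\lambda,u)=\langle\lambda,X(x,u)\rangle-F(x,u),\qquad \lambda\in T^*_xM,$$ be Pontryagin's Hamiltonian for $p_0=-1$. *Constraint algorithm.* Let $N_0$ be the set of points $y\in T^*M\times U$ at which $i_v\Omega=dH(y)$ for some tangent vector $v$ at $y$, and let $\mathfrak X^{N_0}$ be the set of smooth vector fields $Z$ on $T^*M\times U$ with $i_Z\Omega=dH$ on $N_0$. Inductively, let $N_{i+1}$ be the set of $y\in N_i$ such that $Z(y)\in T_yN_i$ for some $Z\in\mathfrak X^{N_i}$, and let $\mathfrak X^{N_{i+1}}$ be the set of $Z\in\mathfrak X^{N_i}$ with $Z(y)\in T_yN_i$ for all $y\in N_{i+1}$. Put $N_f^{[-1]}=\bigcap_iN_i$ and $\mathfrak X^{N_f}=\bigcap_i\mathfrak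 X^{N_i}$. As usual in this algorithm, every $N_i$ is assumed to be a (possibly empty) embedded submanifold. *Normal extremals.* A curve $(\gamma,u)\colon[a,b]\to M\times U$, $a<b$, is a normal extremal if there is a continuous $\lambda\colon[a,b]\to T^*M$ along $\gamma$ such that $(\lambda,u)$ is piecewise $C^1$, $i_{(\dot\lambda(t),\dot u(t))}\Omega=dH(\lambda(t),u(t))$ on the interior of each piece, $H(\lambda(t),u(t))$ is constant on all of $[a,b]$, and $(p_0,\lambda(t))=(-1,\lambda(t))\ne0$ for each $t$. **Proposition.** Let $(\lambda_0,u_0)\in N_f^{[-1]}$. 1. There are $\varepsilon>0$, a vector field $Z\in\mathfrak X^{N_0}$ and an integral curve $(\lambda,u)\colon[-\varepsilon,\varepsilon]\to T^*M\times U$ of $Z$ with $(\lambda,u)(0)=(\lambda_0,u_0)$ that is contained in $N_f^{[-1]}$ and whose projection $(\gamma,u)=(\pi_M\times\mathrm{Id})(\lambda,u)$ is a normal extremal. 2. If $Z\in\mathfrak X^{N_f}$ and $(\lambda,u)\colon[a,b]\to T^*M\times U$, $a<b$, is an integral curve of $Z$ that passes through $(\lambda_0,u_0)$, then $(\lambda,u)$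 is contained in $N_f^{[-1]}$ and its projection $(\gamma,u)=(\pi_M\times\mathrm{Id})(\lambda,u)$ is a normal extremal. -/

import Mathlib

open Set Filter Topology Bundle
open scoped Manifold ContDiff

noncomputable section

section Presymplectic

variable {EY HY : Type*} [NormedAddCommGroup EY] [NormedSpace ℝ EY] [TopologicalSpace HY]
  (J : ModelWithCorners ℝ EY HY) {Y : Type*} [TopologicalSpace Y] [ChartedSpace HY Y]

/-- `N` is a smooth embedded submanifold: around each of its points there is a smooth chart of the
ambient manifold in which `N` is a piece of an affine subspace. The dimension may differ from one
connected component to another, and the empty set is allowed. -/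
def IsSubmanifold (N : Set Y) : Prop :=
  ∀ x ∈ N, ∃ φ ∈ IsManifold.maximalAtlas J ∞ Y, x ∈ φ.source ∧
    ∃ W : Submodule ℝ EY, ∀ y ∈ φ.source, y ∈ N ↔ φ.extend J y - φ.extend J x ∈ W

/-- The tangent vectors at `x` to `N`: velocities at time `0` of smooth curves through `x` that
run in `N`. For a submanifold `N` this is the tangent space `T_x N` inside `T_x Y`. -/
def tangentTo (N : Set Y) (x : Y) : Set (TangentSpace J x) :=
  {v | ∃ c : ℝ → Y, ∃ h : c 0 = x, ContMDiffAt 𝓘(ℝ, ℝ) J ∞ c 0 ∧ (∀ᶠ t in 𝓝 (0 : ℝ), c t ∈ N) ∧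
    v = h ▸ (mfderiv 𝓘(ℝ, ℝ) J c 0 (1 : ℝ) : TangentSpace J (c 0))}

/-- A smooth vector field. -/
def IsSmoothField [IsManifold J 1 Y] (Z : ∀ y : Y, TangentSpace J y) : Prop :=
  ContMDiff J J.tangent ∞ (fun y => (⟨y, Z y⟩ : TangentBundle J Y))

/-- The presymplectic equation `i_v Ω = dH` at the point `y`. -/
def SolvesAt (Ω : ∀ y : Y, TangentSpace J y → TangentSpace J y → ℝ) (H : Y → ℝ) (y : Y)
    (v : TangentSpace J y) : Prop :=
  ∀ w : TangentSpace J y, Ω y v w = mfderiv J 𝓘(ℝ, ℝ) H y w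

/-- The primary constraint set: the points where the presymplectic equation is solvable. -/
def primarySet (Ω : ∀ y : Y, TangentSpace J y → TangentSpace J y → ℝ) (H : Y → ℝ) : Set Y :=
  {y | ∃ v : TangentSpace J y, SolvesAt J Ω H y v}

/-- The set of smooth vector fields that solve the presymplectic equation on the primary set. -/
def primaryFields [IsManifold J 1 Y] (Ω : ∀ y : Y, TangentSpace J y → TangentSpace J y → ℝ) (H : Y → ℝ) :
    Set (∀ y : Y, TangentSpace J y) :=
  {Z | IsSmoothField J Z ∧ ∀ y ∈ primarySet J Ω H, SolvesAt J Ω H y (Z y)}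

/-- One step of the constraint algorithm: from `(N, 𝒳)` keep the points at which some field of `𝒳`
is tangent to `N`, and then the fields of `𝒳` that are tangent to `N` at all these points. -/
def constraintStep (P : Set Y × Set (∀ y : Y, TangentSpace J y)) :
    Set Y × Set (∀ y : Y, TangentSpace J y) :=
  ({x | x ∈ P.1 ∧ ∃ Z ∈ P.2, Z x ∈ tangentTo J P.1 x},
   {Z | Z ∈ P.2 ∧ ∀ x ∈ P.1, (∃ Z' ∈ P.2, Z' x ∈ tangentTo J P.1 x) → Z x ∈ tangentTo J P.1 x})

/-- The pair `(N_i, 𝒳^{N_i})` of the presymplectic constraint algorithm. -/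
def constraintStage [IsManifold J 1 Y] (Ω : ∀ y : Y, TangentSpace J y → TangentSpace J y → ℝ) (H : Y → ℝ) :
    ℕ → Set Y × Set (∀ y : Y, TangentSpace J y)
  | 0 => (primarySet J Ω H, primaryFields J Ω H)
  | i + 1 => constraintStep J (constraintStage Ω H i)

/-- The final constraint set `N_f = ⋂ N_i`. -/
def finalSet [IsManifold J 1 Y] (Ω : ∀ y : Y, TangentSpace J y → TangentSpace J y → ℝ) (H : Y → ℝ) : Set Y :=
  ⋂ i, (constraintStage J Ω H i).1

/-- The final set of solution fields `𝒳^{N_f} = ⋂ 𝒳^{N_i}`. -/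
def finalFields [IsManifold J 1 Y] (Ω : ∀ y : Y, TangentSpace J y → TangentSpace J y → ℝ) (H : Y → ℝ) :
    Set (∀ y : Y, TangentSpace J y) :=
  ⋂ i, (constraintStage J Ω H i).2

end Presymplectic

section Cotangent

/-- The fibre bundle whose fibre at `x` is the dual of `T_x M`. -/
abbrev CotangentFiber (m : ℕ) (M : Type*) [TopologicalSpace M]
    [ChartedSpace (EuclideanSpace ℝ (Fin m)) M] (x : M) : Type :=
  TangentSpace (𝓡 m) x →L[ℝ] Trivial M ℝ x

/-- The cotangent bundle `T*M` of an `m`-dimensional manifold. -/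
abbrev Cotangent (m : ℕ) (M : Type*) [TopologicalSpace M]
    [ChartedSpace (EuclideanSpace ℝ (Fin m)) M] : Type _ :=
  TotalSpace (EuclideanSpace ℝ (Fin m) →L[ℝ] ℝ) (CotangentFiber m M)

/-- The model of `T*M`: position and momentum coordinates. -/
abbrev cotangentModel (m : ℕ) :=
  (𝓡 m).prod 𝓘(ℝ, EuclideanSpace ℝ (Fin m) →L[ℝ] ℝ)

/-- The model of `T*M × U`, for `U` open in `ℝ^k`. -/
abbrev phaseModel (m k : ℕ) :=
  (cotangentModel m).prod (𝓡 k)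

variable {m k : ℕ} {M : Type*} [TopologicalSpace M] [ChartedSpace (EuclideanSpace ℝ (Fin m)) M]
  [IsManifold (𝓡 m) ∞ M]

/-- The canonical symplectic form `Σ dx^i ∧ dp_i` of `T*M` at `l`. A tangent vector at `l` is
represented by its components `(δx, δp)` in the preferred chart at `l`, and this chart is the
natural cotangent chart `(x^i, p_i)` induced by the preferred chart of `M` at the base point. -/
def canonicalForm (l : Cotangent m M) (v w : TangentSpace (cotangentModel m) l) : ℝ :=
  let v' : EuclideanSpace ℝ (Fin m) × (EuclideanSpace ℝ (Fin m) →L[ℝ] ℝ) := v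
  let w' : EuclideanSpace ℝ (Fin m) × (EuclideanSpace ℝ (Fin m) →L[ℝ] ℝ) := w
  w'.2 v'.1 - v'.2 w'.1

variable {U : TopologicalSpace.Opens (EuclideanSpace ℝ (Fin k))}

/-- The presymplectic form of `T*M × U`: the pull-back of the canonical form along the
projection `T*M × U → T*M`. -/
def presymplecticForm (q : Cotangent m M × U) (v w : TangentSpace (phaseModel m k) q) : ℝ :=
  canonicalForm q.1
    (mfderiv (phaseModel m k) (cotangentModel m) (Prod.fst : Cotangent m M × U → _) q v)
    (mfderiv (phaseModel m k) (cotangentModel m) (Prod.fst : Cotangent m M × U → _) q w)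

/-- The projection `π_M × Id : T*M × U → M × U`. -/
def projBase (q : Cotangent m M × U) : M × U := (q.1.proj, q.2)

/-- Pontryagin's Hamiltonian `H(λ, u) = ⟨λ, X(x, u)⟩ + p₀ F(x, u)`, `λ ∈ T*_x M`. -/
def pontryaginH (X : ∀ p : M × U, TangentSpace (𝓡 m) p.1) (F : M × U → ℝ) (p₀ : ℝ)
    (q : Cotangent m M × U) : ℝ :=
  (q.1.snd (X (projBase q)) : ℝ) + p₀ * F (projBase q)

/-- The constraint set `N_i` for the Hamiltonian `H_X + p₀ F`. -/
def constraintSet (X : ∀ p : M × U, TangentSpace (𝓡 m) p.1) (F : M × U → ℝ) (p₀ : ℝ) (i : ℕ) :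
    Set (Cotangent m M × U) :=
  (constraintStage (phaseModel m k) presymplecticForm (pontryaginH X F p₀) i).1

/-- The final constraint set `N_f` for the Hamiltonian `H_X + p₀ F`. -/
def finalConstraintSet (X : ∀ p : M × U, TangentSpace (𝓡 m) p.1) (F : M × U → ℝ) (p₀ : ℝ) :
    Set (Cotangent m M × U) :=
  finalSet (phaseModel m k) presymplecticForm (pontryaginH X F p₀)

/-- The smooth fields on `T*M × U` with `i_Z Ω = dH` on `N_0`, for `H = H_X + p₀ F`. -/
def hamiltonianFields (X : ∀ p : M × U, TangentSpace (𝓡 m) p.1) (F : M × U → ℝ) (p₀ : ℝ) :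
    Set (∀ q : Cotangent m M × U, TangentSpace (phaseModel m k) q) :=
  primaryFields (phaseModel m k) presymplecticForm (pontryaginH X F p₀)

/-- The final solution fields `𝒳^{N_f}` for the Hamiltonian `H_X + p₀ F`. -/
def finalSolutionFields (X : ∀ p : M × U, TangentSpace (𝓡 m) p.1) (F : M × U → ℝ) (p₀ : ℝ) :
    Set (∀ q : Cotangent m M × U, TangentSpace (phaseModel m k) q) :=
  finalFields (phaseModel m k) presymplecticForm (pontryaginH X F p₀)

/-- `c = (λ, u)` satisfies on `[a, b]`, with the constant `p₀`, the necessary conditions of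
Pontryagin's Maximum Principle in presymplectic form. The curve is piecewise `C^1`, `λ` being
continuous; on each piece `i_{ċ} Ω = dH`; the Hamiltonian is constant everywhere along `c`; and
`(p₀, λ(t))` never vanishes. Values of `c` outside `[a, b]` are irrelevant. -/
structure IsBiextremal (X : ∀ p : M × U, TangentSpace (𝓡 m) p.1) (F : M × U → ℝ) (p₀ a b : ℝ)
    (c : ℝ → Cotangent m M × U) : Prop where
  lt : a < b
  continuousOn : ContinuousOn (fun t => (c t).1) (Icc a b)
  pieces : ∃ (n : ℕ) (τ : ℕ → ℝ), τ 0 = a ∧ τ n = b ∧ ∀ i < n, τ i < τ (i + 1) ∧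
    (∃ d : ℝ → Cotangent m M × U,
      ContMDiffOn 𝓘(ℝ, ℝ) (phaseModel m k) 1 d (Icc (τ i) (τ (i + 1))) ∧
      EqOn c d (Ioo (τ i) (τ (i + 1)))) ∧
    ∀ t ∈ Ioo (τ i) (τ (i + 1)), ∃ v : TangentSpace (phaseModel m k) (c t),
      HasMFDerivAt 𝓘(ℝ, ℝ) (phaseModel m k) c t ((1 : ℝ →L[ℝ] ℝ).smulRight v) ∧
      SolvesAt (phaseModel m k) presymplecticForm (pontryaginH X F p₀) (c t) v
  const : ∀ s ∈ Icc a b, ∀ t ∈ Icc a b, pontryaginH X F p₀ (c s) = pontryaginH X F p₀ (c t)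
  ne_zero : ∀ t ∈ Icc a b, (p₀, (c t).1.snd) ≠ 0

/-- `g = (γ, u)` is a normal extremal on `[a, b]`: for some `λ` along `γ` the curve `(λ, u)`
satisfies the necessary conditions with `p₀ = -1`. -/
def IsNormalExtremal (X : ∀ p : M × U, TangentSpace (𝓡 m) p.1) (F : M × U → ℝ) (a b : ℝ)
    (g : ℝ → M × U) : Prop :=
  ∃ l : ℝ → Cotangent m M, (∀ t ∈ Icc a b, (l t).proj = (g t).1) ∧
    IsBiextremal X F (-1) a b (fun t => (l t, (g t).2))

end Cotangent

end

/-! Near a point of $N_f$ the algorithm stabilises, although it may never do so globally. Let $q \in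
N_f$. The dimensions of the $N_i$ at $q$ attain a minimum at some index $i$, and the submanifold
$N_{i+1} \subset N_i$, of the same dimension at $q$, fills $N_i$ on a neighbourhood $V$ of $q$
(`eventually_mem_of_finrank_le`). Any field of the next stage is then tangent on $V$ to the set
where the algorithm stands, so no later stage removes a point of $V$: $N_f = N_i$ on $V$
(`exists_eventually_mem_finalSet`).

A field of stage $i+1$ is tangent to $N_i$ along $N_i \cap V$, so by a Grönwall estimate its
integral curve through $q$ stays in $N_i$, hence in $N_f$, for a short time
(`IsSubmanifold.eventually_mem_of_tangent`). This gives the curve of part 1.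

For part 2 the same argument shows that the times spent in $N_f$ form an open subset of $[a,b]$.
They also form a closed one, although the $N_i$ need not be closed. The set $N_0$ is closed, being
$\{\partial H/\partial u = 0\}$. If a limit point lies in $N_i$, the velocity $Z$ there is a limit
of difference quotients along $N_i$, hence tangent to $N_i$, so the point lies in $N_{i+1}$.
Connectedness of $[a,b]$ concludes.

Along a curve in $N_0$ the equation $i_Z\Omega = dH$ holds, $H$ is constant because $dH(Z) =
\Omega(Z,Z) = 0$, and $p_0 = -1$ makes the nonvanishing condition automatic. -/

/-! ### Vector fields and integral curves in a chart -/

section ChartCoordinates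

variable {EY HY : Type*} [NormedAddCommGroup EY] [NormedSpace ℝ EY] [TopologicalSpace HY]
  {J : ModelWithCorners ℝ EY HY} {Y : Type*} [TopologicalSpace Y] [ChartedSpace HY Y]
  {φ : OpenPartialHomeomorph Y HY}

lemma mdifferentiableAt_extend [IsManifold J ∞ Y] (hφ : φ ∈ IsManifold.maximalAtlas J ∞ Y) {y : Y}
    (hy : y ∈ φ.source) : MDifferentiableAt J 𝓘(ℝ, EY) (φ.extend J) y :=
  ((OpenPartialHomeomorph.contMDiffOn_extend hφ).contMDiffAt (φ.open_source.mem_nhds hy)).mdifferentiableAt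
    (by simp)

lemma contMDiffAt_extend_symm [J.Boundaryless] (hφ : φ ∈ IsManifold.maximalAtlas J ∞ Y) {x : EY}
    (hx : x ∈ (φ.extend J).target) : ContMDiffAt 𝓘(ℝ, EY) J ∞ (φ.extend J).symm x := by
  have h := contMDiffOn_extend_symm hφ
  have h2 : J '' φ.target = (φ.extend J).target := by
    rw [φ.extend_target']
  rw [h2] at h
  exact h.contMDiffAt (φ.isOpen_extend_target.mem_nhds hx)

/-- The components of a vector field in a chart. -/
noncomputable def fieldInChart (J : ModelWithCorners ℝ EY HY) (φ : OpenPartialHomeomorph Y HY)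
    (Z : ∀ y : Y, TangentSpace J y) (y : Y) : EY :=
  mfderiv J 𝓘(ℝ, EY) (φ.extend J) y (Z y)

lemma contMDiffOn_fieldInChart [IsManifold J ∞ Y] [IsManifold J 1 Y]
    (hφ : φ ∈ IsManifold.maximalAtlas J ∞ Y) {Z : ∀ y : Y, TangentSpace J y}
    (hZ : IsSmoothField J Z) :
    ContMDiffOn J 𝓘(ℝ, EY) ∞ (fieldInChart J φ Z) φ.source := by
  have h1 : ContMDiffOn J.tangent 𝓘(ℝ, EY).tangent ∞
      (tangentMapWithin J 𝓘(ℝ, EY) (φ.extend J) φ.source)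
      (π EY (TangentSpace J) ⁻¹' φ.source) :=
    (OpenPartialHomeomorph.contMDiffOn_extend hφ).contMDiffOn_tangentMapWithin (by simp)
      φ.open_source.uniqueMDiffOn
  have h2 := (contMDiff_snd_tangentBundle_modelSpace EY 𝓘(ℝ, EY) (n := ∞)).comp_contMDiffOn
    (h1.comp hZ.contMDiffOn (s := φ.source) fun y hy => hy)
  refine h2.congr fun y hy => ?_
  simp only [fieldInChart, Function.comp, tangentMapWithin]
  rw [mfderivWithin_of_mem_nhds (φ.open_source.mem_nhds hy)]

lemma contDiffAt_fieldInChart [J.Boundaryless] [IsManifold J ∞ Y] [IsManifold J 1 Y]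
    (hφ : φ ∈ IsManifold.maximalAtlas J ∞ Y) {Z : ∀ y : Y, TangentSpace J y}
    (hZ : IsSmoothField J Z) {x : EY} (hx : x ∈ (φ.extend J).target) :
    ContDiffAt ℝ ∞ (fieldInChart J φ Z ∘ (φ.extend J).symm) x := by
  rw [← contMDiffAt_iff_contDiffAt]
  have hs : (φ.extend J).symm x ∈ φ.source := by
    simpa using (φ.extend J).map_target hx
  exact ((contMDiffOn_fieldInChart hφ hZ).contMDiffAt (φ.open_source.mem_nhds hs)).comp x
    (contMDiffAt_extend_symm hφ hx)

lemma IsMIntegralCurveOn.hasDerivWithinAt_extend [IsManifold J ∞ Y]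
    (hφ : φ ∈ IsManifold.maximalAtlas J ∞ Y) {Z : ∀ y : Y, TangentSpace J y} {c : ℝ → Y}
    {s : Set ℝ} (hc : IsMIntegralCurveOn c Z s) {t : ℝ} (ht : t ∈ s) (hs : c t ∈ φ.source) :
    HasDerivWithinAt (φ.extend J ∘ c) (fieldInChart J φ Z (c t)) s t := by
  have h := (mdifferentiableAt_extend hφ hs).hasMFDerivAt.comp_hasMFDerivWithinAt t (hc t ht)
  rw [hasMFDerivWithinAt_iff_hasFDerivWithinAt] at h
  rw [hasDerivWithinAt_iff_hasFDerivWithinAt]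
  refine HasFDerivWithinAt.congr_fderiv h (ContinuousLinearMap.ext fun r => ?_)
  exact (mfderiv J 𝓘(ℝ, EY) (φ.extend J) (c t)).map_smul (show ℝ from r) (Z (c t))

end ChartCoordinates

/-! ### Two facts on curves in normed spaces -/

section RealCurves

/-- Slopes along `S` lie in the closed subspace `W`, and so does their limit. The set `S` may be any
subset of `s` that accumulates at `t`; the closedness argument for part 2 needs this generality. -/
lemma HasDerivWithinAt.mem_of_eventually_sub_mem {E : Type*} [NormedAddCommGroup E]
    [NormedSpace ℝ E] {W : Submodule ℝ E} (hW : IsClosed (W : Set E)) {f : ℝ → E} {v : E}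
    {s S : Set ℝ} {t : ℝ} (hf : HasDerivWithinAt f v s t) (hS : S ⊆ s) (hne : (𝓝[S \ {t}] t).NeBot)
    (hmem : ∀ᶠ r in 𝓝[S] t, f r - f t ∈ W) : v ∈ W := by
  have h := (hasDerivWithinAt_iff_tendsto_slope.1 (hf.mono hS))
  refine hW.mem_of_tendsto h ?_
  filter_upwards [hmem.filter_mono (nhdsWithin_mono t sdiff_subset)] with r hr
  exact W.smul_mem _ hr

/-- Grönwall's inequality forwards and backwards from `t₀`, which may be an endpoint of the
interval. -/
lemma eventually_eq_zero_of_norm_deriv_le {E : Type*} [NormedAddCommGroup E] [NormedSpace ℝ E]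
    {w w' : ℝ → E} {a b t₀ K : ℝ} (h₀ : w t₀ = 0)
    (h : ∀ᶠ t in 𝓝[Icc a b] t₀, HasDerivWithinAt w (w' t) (Icc a b) t ∧ ‖w' t‖ ≤ K * ‖w t‖)
    (ht₀ : t₀ ∈ Icc a b) :
    ∀ᶠ t in 𝓝[Icc a b] t₀, w t = 0 := by
  rw [eventually_nhdsWithin_iff, Metric.eventually_nhds_iff] at h ⊢
  obtain ⟨δ, hδ, h⟩ := h
  refine ⟨δ, hδ, fun t htδ ht => ?_⟩
  have key : ∀ x ∈ uIcc t₀ t, HasDerivWithinAt w (w' x) (Icc a b) x ∧ ‖w' x‖ ≤ K * ‖w x‖ :=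
    fun x hx => h
      ((abs_sub_left_of_mem_uIcc hx).trans_lt htδ) (ordConnected_Icc.uIcc_subset ht₀ ht hx)
  rcases le_total t₀ t with hle | hle
  · rw [uIcc_of_le hle] at key
    refine eq_zero_of_abs_deriv_le_mul_abs_self_of_eq_zero_right (f := w) (f' := w') (K := K)
      (fun x hx => ((key x hx).1.continuousWithinAt).mono (Icc_subset_Icc ht₀.1 ht.2))
      (fun x hx => ?_) h₀ (fun x hx => (key x ⟨hx.1, hx.2.le⟩).2) t ⟨hle, le_rfl⟩
    refine ((key x ⟨hx.1, hx.2.le⟩).1.mono (Icc_subset_Icc (ht₀.1.trans hx.1) ht.2)).mono_of_mem_nhdsWithin ?_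
    exact Icc_mem_nhdsGE hx.2
  · rw [uIcc_of_ge hle] at key
    -- Times before `t₀` are reached by reversing time.
    have hneg : ∀ x ∈ Icc (-t₀) (-t), HasDerivWithinAt (fun s => w (-s)) (-w' (-x)) (Icc (-t₀) (-t)) x ∧
        ‖-w' (-x)‖ ≤ K * ‖w (-x)‖ := by
      intro x hx
      have hx' : -x ∈ Icc t t₀ := ⟨by linarith [hx.2], by linarith [hx.1]⟩
      obtain ⟨h1, h2⟩ := key _ hx'
      refine ⟨?_, by rwa [norm_neg]⟩
      have := (h1.mono (Icc_subset_Icc ht.1 ht₀.2)).scomp x (h := fun s => -s) (s := Icc (-t₀) (-t))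
        (hasDerivWithinAt_neg x _) (fun s hs => ⟨by linarith [hs.2], by linarith [hs.1]⟩)
      simpa [Function.comp_def] using this
    have := eq_zero_of_abs_deriv_le_mul_abs_self_of_eq_zero_right (f := fun s => w (-s))
      (f' := fun s => -w' (-s)) (K := K) (a := -t₀) (b := -t)
      (fun x hx => (hneg x hx).1.continuousWithinAt)
      (fun x hx => ?_) (by simpa using h₀) (fun x hx => (hneg x ⟨hx.1, hx.2.le⟩).2) (-t)
      ⟨by linarith, le_rfl⟩
    · simpa using this
    · refine ((hneg x ⟨hx.1, hx.2.le⟩).1.mono (Icc_subset_Icc hx.1 le_rfl)).mono_of_mem_nhdsWithin ?_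
      exact Icc_mem_nhdsGE hx.2

end RealCurves

/-! ### Tangent spaces of submanifolds in flat charts -/

section FlatCharts

variable {EY HY : Type*} [NormedAddCommGroup EY] [NormedSpace ℝ EY] [TopologicalSpace HY]
  {J : ModelWithCorners ℝ EY HY} {Y : Type*} [TopologicalSpace Y] [ChartedSpace HY Y]
  {φ : OpenPartialHomeomorph Y HY} {N : Set Y} {W : Submodule ℝ EY} {p : EY}

lemma tangentTo_congr {N N' : Set Y} {x : Y} (h : ∀ᶠ y in 𝓝 x, y ∈ N ↔ y ∈ N') :
    tangentTo J N x = tangentTo J N' x := by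
  have key : ∀ {A B : Set Y}, (∀ᶠ y in 𝓝 x, y ∈ A ↔ y ∈ B) → tangentTo J A x ⊆ tangentTo J B x := by
    rintro A B h v ⟨c, rfl, hc, hA, rfl⟩
    refine ⟨c, rfl, hc, ?_, rfl⟩
    filter_upwards [hA, hc.continuousAt.eventually h] with t h1 h2 using h2.1 h1
  exact (key h).antisymm (key (h.mono fun y hy => hy.symm))

variable [FiniteDimensional ℝ EY] [IsManifold J ∞ Y]

/-- The chart image of a curve in `N` has increments in `W`, hence velocity in `W`; conversely, a
direction in `W` is the velocity of a straight line in the chart. -/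
lemma mem_tangentTo_iff [J.Boundaryless] (hφ : φ ∈ IsManifold.maximalAtlas J ∞ Y)
    (hW : ∀ y ∈ φ.source, y ∈ N ↔ φ.extend J y - p ∈ W) {x : Y} (hx : x ∈ φ.source) (hxN : x ∈ N)
    {v : TangentSpace J x} :
    v ∈ tangentTo J N x ↔ (mfderiv J 𝓘(ℝ, EY) (φ.extend J) x v : EY) ∈ W := by
  have hxe : x ∈ (φ.extend J).source := by simpa using hx
  constructor
  · rintro ⟨c, rfl, hc, hN, rfl⟩
    have h := (mdifferentiableAt_extend hφ hx).hasMFDerivAt.comp 0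
      (hc.mdifferentiableAt (by simp)).hasMFDerivAt
    rw [hasMFDerivAt_iff_hasFDerivAt] at h
    have h1 : HasDerivAt (φ.extend J ∘ c)
        (mfderiv J 𝓘(ℝ, EY) (φ.extend J) (c 0) (mfderiv 𝓘(ℝ, ℝ) J c 0 (1 : ℝ)) : EY) 0 :=
      let L : ℝ →L[ℝ] EY :=
        (mfderiv J 𝓘(ℝ, EY) (φ.extend J) (c 0)).comp (mfderiv 𝓘(ℝ, ℝ) J c 0)
      HasFDerivAt.hasDerivAt (f' := L) h
    refine h1.hasDerivWithinAt.mem_of_eventually_sub_mem (s := univ) (S := univ)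
      W.closed_of_finiteDimensional (subset_univ _) ?_ ?_
    · rw [← compl_eq_univ_sdiff]; infer_instance
    · rw [nhdsWithin_univ]
      filter_upwards [hN, hc.continuousAt.eventually (φ.open_source.mem_nhds hx)] with t h1 h2
      have := W.sub_mem ((hW _ h2).1 h1) ((hW _ hx).1 hxN)
      simpa using this
  · intro hv
    set ψ := φ.extend J with hψ
    let d : EY := mfderiv J 𝓘(ℝ, EY) ψ x v
    let c : ℝ → Y := fun t => ψ.symm (ψ x + t • d)
    have hxt : ψ x ∈ ψ.target := ψ.map_source hxe
    have hc0 : c 0 = x := by simp only [c, zero_smul, add_zero]; exact ψ.left_inv hxe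
    have hline : HasDerivAt (fun t : ℝ => ψ x + t • d) d 0 := by
      simpa using ((hasDerivAt_id (0 : ℝ)).smul_const d).const_add (ψ x)
    have hsm : ContMDiffAt 𝓘(ℝ, ℝ) J ∞ c 0 := by
      have h2 : ContMDiffAt 𝓘(ℝ, ℝ) 𝓘(ℝ, EY) ∞ (fun t : ℝ => ψ x + t • d) 0 := by
        rw [contMDiffAt_iff_contDiffAt]; fun_prop
      refine ContMDiffAt.comp (0 : ℝ) ?_ h2
      rw [zero_smul, add_zero]
      exact contMDiffAt_extend_symm hφ hxt
    have htar : ∀ᶠ t in 𝓝 (0 : ℝ), ψ x + t • d ∈ ψ.target := by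
      have : ContinuousAt (fun t : ℝ => ψ x + t • d) 0 := by fun_prop
      refine this.eventually (φ.isOpen_extend_target.mem_nhds ?_)
      simpa only [zero_smul, add_zero] using hxt
    refine ⟨c, hc0, hsm, ?_, ?_⟩
    · filter_upwards [htar] with t ht
      have hs : c t ∈ φ.source := φ.extend_source (I := J) ▸ ψ.map_target ht
      rw [hW _ hs]
      have h3 : ψ (c t) = ψ x + t • d := ψ.right_inv ht
      rw [h3, add_sub_right_comm]
      exact W.add_mem ((hW _ hx).1 hxN) (W.smul_mem _ hv)
    -- The vectors live over `c 0` and `x`, which are only propositionally equal. They are compared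
    -- through the derivative of the chart, which is injective.
    · have hcast : ∀ (y z : Y) (h : y = z) (u : TangentSpace J y) (u' : TangentSpace J z),
          mfderiv J 𝓘(ℝ, EY) ψ z u' = mfderiv J 𝓘(ℝ, EY) ψ y u → z ∈ φ.source → u' = h ▸ u := by
        rintro y _ rfl u u' he hy
        have hinj : Function.Injective (mfderiv J 𝓘(ℝ, EY) ψ y) := by
          have h1 := (mdifferentiableAt_extend (J := J) hφ hy).hasMFDerivAt
          have hye : y ∈ ψ.source := by simpa [ψ] using hy
          have h2 := ((contMDiffAt_extend_symm hφ (ψ.map_source hye)).mdifferentiableAt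
            (by simp)).hasMFDerivAt.comp y h1
          have h3 : HasMFDerivAt J J (ψ.symm ∘ ψ) y (ContinuousLinearMap.id ℝ (TangentSpace J y)) := by
            refine (hasMFDerivAt_id y).congr_of_eventuallyEq ?_
            filter_upwards [φ.open_source.mem_nhds hy] with z hz
            exact ψ.left_inv (by simpa [ψ] using hz)
          have h4 := hasMFDerivAt_unique h2 h3
          intro u u' huu
          have := congrArg (fun L => L u) h4
          have h5 := congrArg (fun L => L u') h4
          simp only [ContinuousLinearMap.comp_apply] at this h5
          rw [huu] at this
          exact this.symm.trans h5
        exact hinj he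
      refine hcast _ _ hc0 _ _ ?_ hx
      have hx' : c 0 ∈ φ.source := by rwa [hc0]
      have h := ((mdifferentiableAt_extend (J := J) hφ hx').hasMFDerivAt.comp 0
        (hsm.mdifferentiableAt (by simp)).hasMFDerivAt)
      rw [hasMFDerivAt_iff_hasFDerivAt] at h
      have h6 : HasFDerivAt (ψ ∘ c) ((1 : ℝ →L[ℝ] ℝ).smulRight d) 0 := by
        refine (hasDerivAt_iff_hasFDerivAt.1 hline).congr_of_eventuallyEq ?_
        filter_upwards [htar] with t ht
        exact ψ.right_inv ht
      have h7 := HasFDerivAt.unique h6 h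
      have h8 := congrArg (fun L => L (1 : ℝ)) h7
      simp only [ContinuousLinearMap.smulRight_apply, one_apply_eq_self, one_smul] at h8
      exact h8

end FlatCharts

/-! ### Invariance of submanifolds, and nested submanifolds of equal dimension -/

section NestedSubmanifolds

variable {EY HY : Type*} [NormedAddCommGroup EY] [NormedSpace ℝ EY] [TopologicalSpace HY]
  {J : ModelWithCorners ℝ EY HY} {Y : Type*} [TopologicalSpace Y] [ChartedSpace HY Y]
  {φ : OpenPartialHomeomorph Y HY} {N : Set Y} {W : Submodule ℝ EY} {p : EY}
  [FiniteDimensional ℝ EY] [J.Boundaryless]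

/-- An integral curve that starts in a submanifold stays there as long as the field is tangent. -/
lemma IsSubmanifold.eventually_mem_of_tangent [IsManifold J ∞ Y] [IsManifold J 1 Y] (hN : IsSubmanifold J N)
    {Z : ∀ y : Y, TangentSpace J y}
    (hZ : IsSmoothField J Z) {c : ℝ → Y} {a b t₀ : ℝ} (ht₀ : t₀ ∈ Icc a b)
    (hc : IsMIntegralCurveOn c Z (Icc a b)) (hq : c t₀ ∈ N)
    (hT : ∀ᶠ y in 𝓝 (c t₀), y ∈ N → Z y ∈ tangentTo J N y) :
    ∀ᶠ t in 𝓝[Icc a b] t₀, c t ∈ N := by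
  obtain ⟨φ, hφ, hs, W, hW⟩ := hN _ hq
  set ψ := φ.extend J with hψ
  set p := ψ (c t₀) with hp
  obtain ⟨P, hP⟩ : W.ClosedComplemented := Submodule.ClosedComplemented.of_finiteDimensional W
  -- `Q` is a projection with kernel `W`, so `Q (ψ y - p)` measures how far `y` is from `N`.
  let Q : EY →L[ℝ] EY := ContinuousLinearMap.id ℝ EY - W.subtypeL.comp P
  have hQ : ∀ x, Q x = x - P x := fun x => rfl
  have hQW : ∀ x ∈ W, Q x = 0 := fun x hx => by rw [hQ, hP ⟨x, hx⟩]; exact sub_self x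
  have hQ0 : ∀ x, Q x = 0 → x ∈ W := fun x hx => by
    rw [hQ, sub_eq_zero] at hx; rw [hx]; exact (P x).2
  have hsrc : ψ.source = φ.source := φ.extend_source
  have hpt : p ∈ ψ.target := ψ.map_source (hsrc ▸ hs)
  have hpsymm : ψ.symm p = c t₀ := ψ.left_inv (hsrc ▸ hs)
  obtain ⟨K, S, hS, hLip⟩ := ((contDiffAt_fieldInChart hφ hZ hpt).of_le
    (by simp : (1 : WithTop ℕ∞) ≤ ∞)).exists_lipschitzOnWith
  set g := fieldInChart J φ Z ∘ ψ.symm with hg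
  have hgW : ∀ᶠ x in 𝓝 p, x ∈ S ∧ (x - p ∈ W → Q (g x) = 0) := by
    have h1 : ∀ᶠ x in 𝓝 p, ψ.symm x ∈ N → Z (ψ.symm x) ∈ tangentTo J N (ψ.symm x) := by
      refine (contMDiffAt_extend_symm hφ hpt).continuousAt.eventually
        (p := fun y => y ∈ N → Z y ∈ tangentTo J N y) ?_
      rw [← hψ, hpsymm]; exact hT
    filter_upwards [hS, h1, φ.isOpen_extend_target.mem_nhds hpt] with x hx h1 hxt
    refine ⟨hx, fun hxW => hQW _ ?_⟩
    have hxs : ψ.symm x ∈ φ.source := hsrc ▸ ψ.map_target hxt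
    have hxN : ψ.symm x ∈ N := by rw [hW _ hxs, ψ.right_inv hxt]; exact hxW
    exact (mem_tangentTo_iff hφ hW hxs hxN).1 (h1 hxN)
  have hcont : Tendsto c (𝓝[Icc a b] t₀) (𝓝 (c t₀)) := hc.continuousWithinAt ht₀
  have hxc : Tendsto (fun t => ψ (c t)) (𝓝[Icc a b] t₀) (𝓝 p) :=
    (φ.continuousAt_extend hs).tendsto.comp hcont
  have hyc : Tendsto (fun t => ψ (c t) - Q (ψ (c t) - p)) (𝓝[Icc a b] t₀) (𝓝 p) := by
    have h2 : Tendsto (fun x => x - Q (x - p)) (𝓝 p) (𝓝 (p - Q (p - p))) :=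
      Continuous.tendsto (by fun_prop) p
    rw [sub_self, map_zero, sub_zero] at h2
    exact h2.comp hxc
  have hev := eventually_eq_zero_of_norm_deriv_le (w := fun t => Q (ψ (c t) - p))
    (w' := fun t => Q (fieldInChart J φ Z (c t))) (K := ‖Q‖ * K) (t₀ := t₀) (a := a) (b := b)
    (by simp [hp]) ?_ ht₀
  · filter_upwards [hev, hcont.eventually (φ.open_source.mem_nhds hs)] with t h1 h2
    exact (hW _ h2).2 (hQ0 _ h1)
  · filter_upwards [hcont.eventually (φ.open_source.mem_nhds hs), hxc.eventually hgW,
      hyc.eventually hgW, self_mem_nhdsWithin] with t hts hx hy ht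
    have hgx : g (ψ (c t)) = fieldInChart J φ Z (c t) := by
      simp only [hg, Function.comp_apply]; rw [ψ.left_inv (hsrc ▸ hts)]
    refine ⟨Q.hasFDerivAt.comp_hasDerivWithinAt t
      ((hc.hasDerivWithinAt_extend hφ ht hts).sub_const p), ?_⟩
    -- Tangency makes `Q ∘ g` vanish at this projected point of `p + W`. The Lipschitz bound on `g`
    -- between it and `ψ (c t)` is then a bound by `‖Q (ψ (c t) - p)‖`.
    have hyW : ψ (c t) - Q (ψ (c t) - p) - p ∈ W := by
      rw [hQ]
      convert (P (ψ (c t) - p)).2 using 1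
      abel
    rw [← hgx, ← sub_zero (Q (g _)), ← hy.2 hyW, ← map_sub, mul_assoc]
    refine (Q.le_opNorm _).trans (mul_le_mul_of_nonneg_left ?_ (norm_nonneg _))
    refine (hLip.norm_sub_le hx.1 hy.1).trans_eq ?_
    rw [sub_sub_cancel]

/-- A submanifold contained in another one whose dimension is not larger is locally equal to it. -/
lemma eventually_mem_of_finrank_le {φ φ' : OpenPartialHomeomorph Y HY} {N N' : Set Y}
    {W W' : Submodule ℝ EY} {x : Y} (hφ : φ ∈ IsManifold.maximalAtlas J ∞ Y)
    (hφ' : φ' ∈ IsManifold.maximalAtlas J ∞ Y) (hx : x ∈ φ.source) (hx' : x ∈ φ'.source)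
    (hW : ∀ y ∈ φ.source, y ∈ N ↔ φ.extend J y - φ.extend J x ∈ W)
    (hW' : ∀ y ∈ φ'.source, y ∈ N' ↔ φ'.extend J y - φ'.extend J x ∈ W')
    (hNN : N' ⊆ N) (hdim : Module.finrank ℝ W ≤ Module.finrank ℝ W') :
    ∀ᶠ y in 𝓝 x, y ∈ N → y ∈ N' := by
  set ψ := φ.extend J with hψ
  set ψ' := φ'.extend J with hψ'
  have hsrc : ψ.source = φ.source := φ.extend_source
  have hsrc' : ψ'.source = φ'.source := φ'.extend_source
  set G := ψ ∘ ψ'.symm with hG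
  set G' := ψ' ∘ ψ.symm with hG'
  have hxt : ψ x ∈ ψ.target := ψ.map_source (hsrc ▸ hx)
  have hxt' : ψ' x ∈ ψ'.target := ψ'.map_source (hsrc' ▸ hx')
  have hxs : ψ.symm (ψ x) = x := ψ.left_inv (hsrc ▸ hx)
  have hxs' : ψ'.symm (ψ' x) = x := ψ'.left_inv (hsrc' ▸ hx')
  have hGx : G (ψ' x) = ψ x := by simp only [hG, Function.comp_apply, hxs']
  have hGc : ContDiffAt ℝ ∞ G (ψ' x) := by
    rw [← contMDiffAt_iff_contDiffAt]
    refine ContMDiffAt.comp _ ?_ (contMDiffAt_extend_symm hφ' hxt')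
    rw [hxs']
    exact (OpenPartialHomeomorph.contMDiffOn_extend hφ).contMDiffAt (φ.open_source.mem_nhds hx)
  have hGc' : ContDiffAt ℝ ∞ G' (ψ x) := by
    rw [← contMDiffAt_iff_contDiffAt]
    refine ContMDiffAt.comp _ ?_ (contMDiffAt_extend_symm hφ hxt)
    rw [hxs]
    exact (OpenPartialHomeomorph.contMDiffOn_extend hφ').contMDiffAt (φ'.open_source.mem_nhds hx')
  have hsymm' : Tendsto ψ'.symm (𝓝 (ψ' x)) (𝓝 x) := by
    have := (contMDiffAt_extend_symm hφ' hxt').continuousAt.tendsto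
    rwa [← hψ', hxs'] at this
  set A := fderiv ℝ G (ψ' x) with hA
  have hGA : HasStrictFDerivAt G A (ψ' x) := hGc.hasStrictFDerivAt (by simp)
  -- The transition map `G` is inverted near the point by `G'`.
  have hAinj : Function.Injective A := by
    have h1 : HasFDerivAt G' (fderiv ℝ G' (ψ x)) (G (ψ' x)) := by
      rw [hGx]; exact (hGc'.differentiableAt (by simp)).hasFDerivAt
    have h2 := h1.comp (ψ' x) hGA.hasFDerivAt
    have h3 : HasFDerivAt (G' ∘ G) (ContinuousLinearMap.id ℝ EY) (ψ' x) := by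
      refine (hasFDerivAt_id (ψ' x)).congr_of_eventuallyEq ?_
      filter_upwards [hsymm'.eventually (φ.open_source.mem_nhds hx),
        φ'.isOpen_extend_target.mem_nhds hxt'] with z hz hz'
      simp only [hG, hG', Function.comp_apply, id]
      rw [ψ.left_inv (hsrc ▸ hz), ψ'.right_inv hz']
    have h4 := h2.unique h3
    exact Function.LeftInverse.injective (g := fderiv ℝ G' (ψ x)) fun u =>
      congrArg (fun L : EY →L[ℝ] EY => L u) h4
  have hmem : ∀ᶠ w : W' in 𝓝 0, (w : EY) + ψ' x ∈ ψ'.target ∧ G (w + ψ' x) - ψ x ∈ W ∧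
      ψ'.symm (w + ψ' x) ∈ N' := by
    have hc : Tendsto (fun w : W' => (w : EY) + ψ' x) (𝓝 0) (𝓝 (ψ' x)) := by
      have : Continuous fun w : W' => (w : EY) + ψ' x := by fun_prop
      simpa using this.tendsto 0
    filter_upwards [(hsymm'.comp hc).eventually (φ.open_source.mem_nhds hx),
        hc.eventually (φ'.isOpen_extend_target.mem_nhds hxt')] with w hw hw'
    have hN' : ψ'.symm (w + ψ' x) ∈ N' := by
      rw [hW' _ (hsrc' ▸ ψ'.map_target hw'), ψ'.right_inv hw', add_sub_cancel_right]
      exact w.2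
    exact ⟨hw', (hW _ hw).1 (hNN hN'), hN'⟩
  have hAW : ∀ w ∈ W', A w ∈ W := by
    intro w hw
    have hl : HasDerivAt (fun t : ℝ => t • w + ψ' x) w 0 := by
      simpa using ((hasDerivAt_id (0 : ℝ)).smul_const w).add_const (ψ' x)
    have h1 : HasDerivAt (fun t : ℝ => G (t • w + ψ' x)) (A w) 0 := by
      refine HasFDerivAt.comp_hasDerivAt (l := G) (0 : ℝ) ?_ hl
      simpa using hGA.hasFDerivAt
    refine h1.hasDerivWithinAt.mem_of_eventually_sub_mem (s := univ) (S := univ)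
      W.closed_of_finiteDimensional (subset_univ _) ?_ ?_
    · rw [← compl_eq_univ_sdiff]; infer_instance
    · rw [nhdsWithin_univ]
      have hc : Tendsto (fun t : ℝ => t • (⟨w, hw⟩ : W')) (𝓝 0) (𝓝 0) := by
        have : Continuous fun t : ℝ => t • (⟨w, hw⟩ : W') := by fun_prop
        simpa using this.tendsto 0
      filter_upwards [hc.eventually hmem] with t ht
      simpa [hGx] using ht.2.1
  obtain ⟨P, hP⟩ : W.ClosedComplemented := Submodule.ClosedComplemented.of_finiteDimensional W
  -- In coordinates, `h` is the inclusion of `N'` into `N`. Its derivative `D` is injective, hence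
  -- bijective by the dimension bound, so `h` covers a neighbourhood of `0` in `W`.
  let h : W' → W := fun w => P (G (w + ψ' x) - ψ x)
  let D : W' →L[ℝ] W := P.comp (A.comp W'.subtypeL)
  have hD : HasStrictFDerivAt h D 0 := by
    refine P.hasStrictFDerivAt.comp (0 : W') (HasStrictFDerivAt.sub_const _ ?_)
    refine HasStrictFDerivAt.comp (g := G) (0 : W') ?_ (W'.subtypeL.hasStrictFDerivAt.add_const _)
    simpa using hGA
  have hDcoe : ∀ w, (D w : EY) = A w := fun w => by
    have := hP ⟨A w, hAW _ w.2⟩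
    exact congrArg Subtype.val this
  have hDinj : Function.Injective D := fun u v huv =>
    Subtype.ext (hAinj (by rw [← hDcoe, ← hDcoe, huv]))
  have hDsurj : Function.Surjective D :=
    (LinearMap.injective_iff_surjective_of_finrank_eq_finrank (f := (D : W' →ₗ[ℝ] W))
      (le_antisymm (LinearMap.finrank_le_finrank_of_injective (f := (D : W' →ₗ[ℝ] W)) hDinj)
        hdim)).1 hDinj
  have hmap := hD.map_nhds_eq_of_surj (LinearMap.range_eq_top.2 hDsurj)
  have h0 : h 0 = 0 := by simp [h, hGx]
  rw [h0] at hmap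
  have himg : ∀ᶠ v : W in 𝓝 0, ∃ w : W', h w = v ∧ (w : EY) + ψ' x ∈ ψ'.target ∧
      G (w + ψ' x) - ψ x ∈ W ∧ ψ'.symm (w + ψ' x) ∈ N' ∧ ψ'.symm (w + ψ' x) ∈ φ.source := by
    rw [← hmap, eventually_map]
    have hc : Tendsto (fun w : W' => (w : EY) + ψ' x) (𝓝 0) (𝓝 (ψ' x)) := by
      have : Continuous fun w : W' => (w : EY) + ψ' x := by fun_prop
      simpa using this.tendsto 0
    filter_upwards [hmem, (hsymm'.comp hc).eventually (φ.open_source.mem_nhds hx)] with w hw hw2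
    exact ⟨w, rfl, hw.1, hw.2.1, hw.2.2, hw2⟩
  rw [nhds_subtype_eq_comap, eventually_comap] at himg
  have hψc : Tendsto (fun y => ψ y - ψ x) (𝓝 x) (𝓝 ((0 : W) : EY)) := by
    have := (φ.continuousAt_extend (I := J) hx).tendsto.sub_const (ψ x)
    rwa [sub_self] at this
  filter_upwards [hψc.eventually himg, φ.open_source.mem_nhds hx] with y hy hys hyN
  obtain ⟨w, hw, hw1, hw2, hw3, hw4⟩ := hy ⟨ψ y - ψ x, (hW _ hys).1 hyN⟩ rfl
  -- Both sides lie in `W`, where `P` is the identity.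
  have h5 : G (w + ψ' x) - ψ x = ψ y - ψ x := by
    have h6 := hP ⟨_, hw2⟩
    have h7 := congrArg Subtype.val (h6.symm.trans hw)
    exact h7
  have h8 : ψ.symm (G (w + ψ' x)) = y := by rw [sub_left_inj.1 h5, ψ.left_inv (hsrc ▸ hys)]
  rw [← h8]
  simp only [hG, Function.comp_apply]
  rwa [ψ.left_inv (hsrc ▸ hw4)]

end NestedSubmanifolds

/-! ### Local stabilisation of the algorithm and invariance of the final set -/

section ConstraintAlgorithm

variable {EY HY : Type*} [NormedAddCommGroup EY] [NormedSpace ℝ EY] [TopologicalSpace HY]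
  {J : ModelWithCorners ℝ EY HY} {Y : Type*} [TopologicalSpace Y] [ChartedSpace HY Y]
  [IsManifold J 1 Y] {Ω : ∀ y : Y, TangentSpace J y → TangentSpace J y → ℝ} {H : Y → ℝ}

lemma constraintStage_fst_antitone :
    Antitone fun i => (constraintStage J Ω H i).1 :=
  antitone_nat_of_succ_le fun _ _ hy => hy.1

lemma constraintStage_snd_antitone :
    Antitone fun i => (constraintStage J Ω H i).2 :=
  antitone_nat_of_succ_le fun _ _ hZ => hZ.1

lemma mem_tangentTo_of_mem_constraintStage_succ {i : ℕ} {Z : ∀ y : Y, TangentSpace J y}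
    (hZ : Z ∈ (constraintStage J Ω H (i + 1)).2) {y : Y}
    (hy : y ∈ (constraintStage J Ω H (i + 1)).1) :
    Z y ∈ tangentTo J (constraintStage J Ω H i).1 y :=
  hZ.2 y hy.1 hy.2

lemma finalSet_subset (i : ℕ) : finalSet J Ω H ⊆ (constraintStage J Ω H i).1 :=
  iInter_subset _ i

/-- Near a point of the final constraint set the constraint algorithm stabilises. -/
lemma exists_eventually_mem_finalSet [FiniteDimensional ℝ EY] [J.Boundaryless]
    (hN : ∀ i, IsSubmanifold J (constraintStage J Ω H i).1) {q : Y} (hq : q ∈ finalSet J Ω H) :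
    ∃ i, ∀ᶠ y in 𝓝 q, y ∈ (constraintStage J Ω H i).1 → y ∈ finalSet J Ω H := by
  have hqi : ∀ i, q ∈ (constraintStage J Ω H i).1 := fun i => finalSet_subset i hq
  choose φ hφ hs W hW using fun i => hN i q (hqi i)
  let i₀ := Function.argmin fun i => Module.finrank ℝ (W i)
  have hmin : ∀ j, Module.finrank ℝ (W i₀) ≤ Module.finrank ℝ (W j) :=
    fun j => Function.argmin_le (fun i => Module.finrank ℝ (W i)) j
  have h1 := eventually_mem_of_finrank_le (hφ i₀) (hφ (i₀ + 1)) (hs i₀) (hs (i₀ + 1)) (hW i₀)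
    (hW (i₀ + 1)) (constraintStage_fst_antitone (Nat.le_succ i₀)) (hmin _)
  obtain ⟨V, hV, hVo, hqV⟩ := eventually_nhds_iff.1 h1
  -- `V` is chosen before the induction, so one neighbourhood serves all later stages at once.
  have key : ∀ j, ∀ y ∈ V, y ∈ (constraintStage J Ω H i₀).1 →
      y ∈ (constraintStage J Ω H (i₀ + j)).1 ∧ y ∈ (constraintStage J Ω H (i₀ + j + 1)).1 := by
    intro j
    induction j with
    | zero => exact fun y hy hy0 => ⟨hy0, hV y hy hy0⟩
    | succ j ih =>
      intro y hy hy0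
      refine ⟨(ih y hy hy0).2, (ih y hy hy0).2, ?_⟩
      -- The point `q` only serves to show that some field survives to stage `i₀ + j + 1`. That
      -- field is tangent to the preceding set, which agrees on `V` with the current one.
      obtain ⟨-, Z, hZ, -⟩ := hqi (i₀ + j + 1 + 1)
      refine ⟨Z, hZ, ?_⟩
      rw [← tangentTo_congr (N := (constraintStage J Ω H (i₀ + j)).1)]
      · exact mem_tangentTo_of_mem_constraintStage_succ hZ (ih y hy hy0).2
      · filter_upwards [hVo.mem_nhds hy] with z hz
        exact ⟨fun h => (ih z hz (constraintStage_fst_antitone (Nat.le_add_right _ _) h)).2,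
          fun h => constraintStage_fst_antitone (Nat.le_succ _) h⟩
  refine ⟨i₀, ?_⟩
  filter_upwards [hVo.mem_nhds hqV] with y hy hy0
  refine mem_iInter.2 fun i => ?_
  exact constraintStage_fst_antitone (Nat.le_add_left i i₀) (key i y hy hy0).1

/-- Where stage `i` agrees with the final set, all its points lie in stage `i + 1`, along which `Z`
is tangent to stage `i`. A field of that one stage suffices; it need not lie in `finalFields`. -/
lemma eventually_mem_finalSet_of_integralCurve [FiniteDimensional ℝ EY] [J.Boundaryless]
    [IsManifold J ∞ Y] {i : ℕ} (hN : IsSubmanifold J (constraintStage J Ω H i).1)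
    {Z : ∀ y : Y, TangentSpace J y} (hZs : IsSmoothField J Z)
    (hZ : Z ∈ (constraintStage J Ω H (i + 1)).2) {c : ℝ → Y} {a b t₀ : ℝ} (ht₀ : t₀ ∈ Icc a b)
    (hc : IsMIntegralCurveOn c Z (Icc a b)) (hq : c t₀ ∈ finalSet J Ω H)
    (hi : ∀ᶠ y in 𝓝 (c t₀), y ∈ (constraintStage J Ω H i).1 → y ∈ finalSet J Ω H) :
    ∀ᶠ t in 𝓝[Icc a b] t₀, c t ∈ finalSet J Ω H := by
  have hev := hN.eventually_mem_of_tangent hZs ht₀ hc (finalSet_subset i hq) (by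
    filter_upwards [hi] with y hy hyi
    exact mem_tangentTo_of_mem_constraintStage_succ hZ (finalSet_subset (i + 1) (hy hyi)))
  have hcont : Tendsto c (𝓝[Icc a b] t₀) (𝓝 (c t₀)) := hc.continuousWithinAt ht₀
  filter_upwards [hev, hcont.eventually hi] with t h1 h2 using h2 h1

lemma IsSmoothField.of_mem_constraintStage {i : ℕ} {Z : ∀ y : Y, TangentSpace J y}
    (hZ : Z ∈ (constraintStage J Ω H i).2) : IsSmoothField J Z :=
  (constraintStage_snd_antitone (Nat.zero_le i) hZ).1

/-- An integral curve of a final solution field that meets the final constraint set stays in it. -/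
lemma forall_mem_finalSet_of_integralCurve [FiniteDimensional ℝ EY] [J.Boundaryless]
    [IsManifold J ∞ Y] (hN : ∀ i, IsSubmanifold J (constraintStage J Ω H i).1)
    (hclosed : IsClosed (primarySet J Ω H))
    {Z : ∀ y : Y, TangentSpace J y} (hZ : Z ∈ finalFields J Ω H) {c : ℝ → Y} {a b t₀ : ℝ}
    (ht₀ : t₀ ∈ Icc a b) (hc : IsMIntegralCurveOn c Z (Icc a b)) (hq : c t₀ ∈ finalSet J Ω H) :
    ∀ t ∈ Icc a b, c t ∈ finalSet J Ω H := by
  have hZi : ∀ i, Z ∈ (constraintStage J Ω H i).2 := mem_iInter.1 hZ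
  have hZs : IsSmoothField J Z := IsSmoothField.of_mem_constraintStage (hZi 0)
  set T : Set ℝ := {t | t ∈ Icc a b ∧ c t ∈ finalSet J Ω H} with hT
  have hclosure : ∀ t ∈ Icc a b, t ∈ closure T → t ∈ T := by
    intro t ht htT
    by_contra hnt
    -- Since `t ∉ T`, the times in `T` accumulate at `t` without meeting it, so difference quotients
    -- can be taken along `T`.
    have hne : (𝓝[T \ {t}] t).NeBot := by
      rw [sdiff_singleton_eq_self hnt]
      exact mem_closure_iff_nhdsWithin_neBot.1 htT
    have hTs : T ⊆ Icc a b := fun r hr => hr.1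
    refine hnt ⟨ht, mem_iInter.2 fun i => ?_⟩
    have hcont : Tendsto c (𝓝[T] t) (𝓝 (c t)) := (hc.continuousWithinAt ht).mono hTs
    have hmem : ∀ᶠ r in 𝓝[T] t, c r ∈ finalSet J Ω H := by
      filter_upwards [self_mem_nhdsWithin] with r hr using hr.2
    induction i with
    | zero =>
      have : (𝓝[T] t).NeBot := mem_closure_iff_nhdsWithin_neBot.1 htT
      exact hclosed.mem_of_tendsto hcont (hmem.mono fun r hr => finalSet_subset 0 hr)
    | succ i ih =>
      obtain ⟨φ, hφ, hs, W, hW⟩ := hN i (c t) ih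
      -- The field `Z` itself witnesses membership in the next stage: its value at the limit point
      -- is a limit of slopes along stage `i`.
      refine ⟨ih, Z, hZi i, (mem_tangentTo_iff hφ hW hs ih).2 ?_⟩
      refine (hc.hasDerivWithinAt_extend hφ ht hs).mem_of_eventually_sub_mem
        W.closed_of_finiteDimensional hTs hne ?_
      filter_upwards [hmem, hcont.eventually (φ.open_source.mem_nhds hs)] with r hr hrs
      exact (hW _ hrs).1 (finalSet_subset i hr)
  have hclopen : IsClopen {t : Icc a b | c t ∈ finalSet J Ω H} := by
    constructor
    · refine isClosed_of_closure_subset fun t ht => (hclosure t t.2 ?_).2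
      refine closure_mono ?_ (image_closure_subset_closure_image continuous_subtype_val
        (mem_image_of_mem _ ht))
      rintro _ ⟨r, hr, rfl⟩
      exact ⟨r.2, hr⟩
    · refine isOpen_iff_eventually.2 fun t ht => ?_
      refine (eventually_nhds_subtype_iff (Icc a b) t fun r => c r ∈ finalSet J Ω H).2 ?_
      obtain ⟨i, hi⟩ := exists_eventually_mem_finalSet hN ht
      exact eventually_mem_finalSet_of_integralCurve (hN i) hZs (hZi (i + 1)) t.2 hc ht hi
  have : PreconnectedSpace (Icc a b) := isPreconnected_iff_preconnectedSpace.1 isPreconnected_Icc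
  have huniv := hclopen.eq_univ ⟨⟨t₀, ht₀⟩, hq⟩
  exact fun t ht => huniv.ge (mem_univ (⟨t, ht⟩ : Icc a b))

end ConstraintAlgorithm

/-! ### Regularity and conservation along integral curves -/

section IntegralCurves

variable {EY HY : Type*} [NormedAddCommGroup EY] [NormedSpace ℝ EY] [TopologicalSpace HY]
  {J : ModelWithCorners ℝ EY HY} {Y : Type*} [TopologicalSpace Y] [ChartedSpace HY Y]

/-- In a chart the derivative of the curve is the field along the curve, which is continuous. -/
lemma IsMIntegralCurveOn.contMDiffOn_Icc [IsManifold J ∞ Y] [IsManifold J 1 Y]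
    {Z : ∀ y : Y, TangentSpace J y}
    (hZ : IsSmoothField J Z) {c : ℝ → Y} {a b : ℝ} (hab : a < b)
    (hc : IsMIntegralCurveOn c Z (Icc a b)) : ContMDiffOn 𝓘(ℝ, ℝ) J 1 c (Icc a b) := by
  intro t₀ ht₀
  rw [contMDiffWithinAt_iff_target, contMDiffWithinAt_iff_contDiffWithinAt]
  refine ⟨hc.continuousWithinAt ht₀, ?_⟩
  set φ := chartAt HY (c t₀) with hφ
  have hatlas : φ ∈ IsManifold.maximalAtlas J ∞ Y := IsManifold.chart_mem_maximalAtlas _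
  obtain ⟨O, hO, hOs⟩ := continuousOn_iff'.1 hc.continuousOn φ.source φ.open_source
  have hmem : ∀ t ∈ Icc a b ∩ O, c t ∈ φ.source := fun t ht =>
    (hOs.ge ⟨ht.2, ht.1⟩).1
  have hsub : Icc a b ∩ O ⊆ Icc a b := inter_subset_left
  have hd : ∀ t ∈ Icc a b ∩ O, HasDerivWithinAt (φ.extend J ∘ c) (fieldInChart J φ Z (c t))
      (Icc a b ∩ O) t := fun t ht =>
    (hc.hasDerivWithinAt_extend hatlas ht.1 (hmem t ht)).mono hsub
  have hu : UniqueDiffOn ℝ (Icc a b ∩ O) := (uniqueDiffOn_Icc hab).inter hO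
  have hC : ContDiffOn ℝ 1 (φ.extend J ∘ c) (Icc a b ∩ O) := by
    rw [contDiffOn_one_iff_derivWithin hu]
    refine ⟨fun t ht => (hd t ht).differentiableWithinAt, ?_⟩
    refine ContinuousOn.congr (f := fun t => fieldInChart J φ Z (c t)) ?_
      fun t ht => (hd t ht).derivWithin (hu t ht)
    exact (contMDiffOn_fieldInChart hatlas hZ).continuousOn.comp (hc.continuousOn.mono hsub) hmem
  have ht₀O : t₀ ∈ O := (hOs.le ⟨mem_chart_source HY (c t₀), ht₀⟩).1
  exact (hC t₀ ⟨ht₀, ht₀O⟩).mono_of_mem_nhdsWithin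
    (inter_mem_nhdsWithin (Icc a b) (hO.mem_nhds ht₀O))

lemma IsMIntegralCurveOn.eq_of_mfderiv_eq_zero {Z : ∀ y : Y, TangentSpace J y} {H : Y → ℝ}
    (hH : MDifferentiable J 𝓘(ℝ, ℝ) H) {c : ℝ → Y} {a b : ℝ} (hab : a < b)
    (hc : IsMIntegralCurveOn c Z (Icc a b))
    (h0 : ∀ t ∈ Icc a b, mfderiv J 𝓘(ℝ, ℝ) H (c t) (Z (c t)) = (0 : ℝ)) :
    ∀ s ∈ Icc a b, ∀ t ∈ Icc a b, H (c s) = H (c t) := by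
  have hd : ∀ t ∈ Icc a b, HasDerivWithinAt (H ∘ c) 0 (Icc a b) t := by
    intro t ht
    have h := (hH (c t)).hasMFDerivAt.comp_hasMFDerivWithinAt t (hc t ht)
    rw [hasMFDerivWithinAt_iff_hasFDerivWithinAt] at h
    rw [hasDerivWithinAt_iff_hasFDerivWithinAt]
    refine HasFDerivWithinAt.congr_fderiv h (ContinuousLinearMap.ext fun r => ?_)
    refine ((mfderiv J 𝓘(ℝ, ℝ) H (c t)).map_smul (show ℝ from r) (Z (c t))).trans ?_
    rw [h0 t ht]
    exact (mul_zero (show ℝ from r)).trans (mul_zero (show ℝ from r)).symm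
  have hconst := constant_of_derivWithin_zero (f := H ∘ c) (a := a) (b := b)
    (fun t ht => (hd t ht).differentiableWithinAt)
    fun t ht => (hd t (Ico_subset_Icc_self ht)).derivWithin
      (uniqueDiffOn_Icc hab t (Ico_subset_Icc_self ht))
  exact fun s hs t ht => (hconst s hs).trans (hconst t ht).symm

end IntegralCurves

/-! ### Pontryagin's Hamiltonian and its primary constraint set -/

section Hamiltonian

variable {m k : ℕ} {M : Type*} [TopologicalSpace M] [ChartedSpace (EuclideanSpace ℝ (Fin m)) M]
  [IsManifold (𝓡 m) ∞ M] {U : TopologicalSpace.Opens (EuclideanSpace ℝ (Fin k))}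

lemma contMDiff_pontryaginH {X : ∀ p : M × U, TangentSpace (𝓡 m) p.1}
    (hX : ContMDiff ((𝓡 m).prod (𝓡 k)) (𝓡 m).tangent ∞
      (fun p : M × U => (⟨p.1, X p⟩ : TangentBundle (𝓡 m) M)))
    {F : M × U → ℝ} (hF : ContMDiff ((𝓡 m).prod (𝓡 k)) 𝓘(ℝ, ℝ) ∞ F) (p₀ : ℝ) :
    ContMDiff (phaseModel m k) 𝓘(ℝ, ℝ) ∞ (pontryaginH X F p₀) := by
  have hproj : ContMDiff (phaseModel m k) ((𝓡 m).prod (𝓡 k)) ∞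
      (projBase : Cotangent m M × U → M × U) :=
    ((contMDiff_proj (CotangentFiber m M)).comp contMDiff_fst).prodMk contMDiff_snd
  have hl : ContMDiff (phaseModel m k) (cotangentModel m) ∞
      (fun q : Cotangent m M × U => TotalSpace.mk' (EuclideanSpace ℝ (Fin m) →L[ℝ] ℝ)
        (E := CotangentFiber m M) q.1.proj q.1.snd) := contMDiff_fst
  have hv : ContMDiff (phaseModel m k) (𝓡 m).tangent ∞
      (fun q : Cotangent m M × U => TotalSpace.mk' (EuclideanSpace ℝ (Fin m))
        (E := fun x : M => TangentSpace (𝓡 m) x) q.1.proj (X (projBase q))) := hX.comp hproj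
  have h1 := hl.clm_bundle_apply hv
  have h2 : ContMDiff (phaseModel m k) 𝓘(ℝ, ℝ) ∞
      (fun q : Cotangent m M × U => (q.1.snd (X (projBase q)) : ℝ)) := by
    exact fun q => (contMDiffAt_totalSpace.1 (h1 q)).2
  exact h2.add (contMDiff_const.mul (hF.comp hproj))

lemma presymplecticForm_apply (q : Cotangent m M × U) (v w : TangentSpace (phaseModel m k) q) :
    presymplecticForm q v w =
      (show EuclideanSpace ℝ (Fin m) →L[ℝ] ℝ from w.1.2)
        (show EuclideanSpace ℝ (Fin m) from v.1.1) -
      (show EuclideanSpace ℝ (Fin m) →L[ℝ] ℝ from v.1.2)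
        (show EuclideanSpace ℝ (Fin m) from w.1.1) := by
  simp only [presymplecticForm, canonicalForm, mfderiv_fst]
  rfl

lemma exists_apply_eq_of_dual_dual {E : Type*} [NormedAddCommGroup E] [NormedSpace ℝ E]
    [FiniteDimensional ℝ E] (l : (E →L[ℝ] ℝ) →L[ℝ] ℝ) : ∃ e : E, ∀ f : E →L[ℝ] ℝ, l f = f e := by
  let L : Module.Dual ℝ (Module.Dual ℝ E) :=
    (l : (E →L[ℝ] ℝ) →ₗ[ℝ] ℝ).comp
      (LinearMap.toContinuousLinearMap : (E →ₗ[ℝ] ℝ) ≃ₗ[ℝ] (E →L[ℝ] ℝ)).toLinearMap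
  obtain ⟨e, he⟩ := (Module.evalEquiv ℝ E).surjective L
  refine ⟨e, fun f => ?_⟩
  exact (congrArg (fun T : Module.Dual ℝ (Module.Dual ℝ E) => T (f : E →ₗ[ℝ] ℝ)) he).symm

/-- The canonical form is nondegenerate, so the covectors $i_v\Omega$ are exactly those that vanish
on the control directions: $N_0 = \{\partial H/\partial u = 0\}$. -/
lemma mem_primarySet_iff {H : Cotangent m M × U → ℝ} {q : Cotangent m M × U} :
    q ∈ primarySet (phaseModel m k) presymplecticForm H ↔
      ∀ w : EuclideanSpace ℝ (Fin k),
        mfderiv (phaseModel m k) 𝓘(ℝ, ℝ) H q ((0, w) : (EuclideanSpace ℝ (Fin m) ×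
          (EuclideanSpace ℝ (Fin m) →L[ℝ] ℝ)) × EuclideanSpace ℝ (Fin k)) = (0 : ℝ) := by
  constructor
  · rintro ⟨v, hv⟩ w
    refine (hv _).symm.trans ((presymplecticForm_apply q v _).trans ?_)
    exact (congrArg₂ (· - ·) rfl (map_zero (show EuclideanSpace ℝ (Fin m) →L[ℝ] ℝ from v.1.2))).trans
      (sub_zero (0 : ℝ))
  · intro h
    let D : (EuclideanSpace ℝ (Fin m) × (EuclideanSpace ℝ (Fin m) →L[ℝ] ℝ)) ×
      EuclideanSpace ℝ (Fin k) →L[ℝ] ℝ := mfderiv (phaseModel m k) 𝓘(ℝ, ℝ) H q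
    -- Hamilton's equations: `e` is $\partial H/\partial p$, read as a vector by biduality, and `f`
    -- is $-\partial H/\partial x$. The control component is free and set to `0`.
    obtain ⟨e, he⟩ := exists_apply_eq_of_dual_dual (D.comp ((ContinuousLinearMap.inl ℝ _ _).comp
      (ContinuousLinearMap.inr ℝ _ _)))
    let f : EuclideanSpace ℝ (Fin m) →L[ℝ] ℝ := -(D.comp ((ContinuousLinearMap.inl ℝ _ _).comp
      (ContinuousLinearMap.inl ℝ _ _)))
    refine ⟨(((e, f), 0) : (EuclideanSpace ℝ (Fin m) × (EuclideanSpace ℝ (Fin m) →L[ℝ] ℝ)) ×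
      EuclideanSpace ℝ (Fin k)), fun w => ?_⟩
    refine (presymplecticForm_apply q _ w).trans ?_
    obtain ⟨⟨x, p⟩, u⟩ := w
    change p e - f x = D ((x, p), u)
    rw [← he p]
    have h0 : D (0, u) = 0 := h u
    have hsum : ((x, p), u) = ((x, 0), 0) + ((0, p), 0) +
      (((0, 0), u) : (EuclideanSpace ℝ (Fin m) × (EuclideanSpace ℝ (Fin m) →L[ℝ] ℝ)) ×
      EuclideanSpace ℝ (Fin k)) := by simp
    have h0' : D ((0, 0), u) = 0 := h0
    rw [hsum, map_add, map_add, h0']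
    simp [f]
    ring

lemma continuous_const_field (w : EuclideanSpace ℝ (Fin k)) :
    Continuous fun u : U => (⟨u, w⟩ : TangentBundle (𝓡 k) U) := by
  refine continuous_iff_continuousAt.2 fun u₀ => ?_
  rw [FiberBundle.continuousAt_totalSpace]
  refine ⟨continuousAt_id, ?_⟩
  -- All points of `U` share one chart, so the coordinates of `w` do not depend on the point.
  refine (continuousAt_const (y := w)).congr (Eventually.of_forall fun u => ?_)
  have h := tangentCoordChange_self (I := 𝓡 k) (x := u) (z := u) (v := w)
    (mem_extChartAt_source u)
  exact h.symm

lemma continuous_vertical_field (w : EuclideanSpace ℝ (Fin k)) :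
    Continuous fun q : Cotangent m M × U => (⟨q, ((0, w) : (EuclideanSpace ℝ (Fin m) ×
      (EuclideanSpace ℝ (Fin m) →L[ℝ] ℝ)) × EuclideanSpace ℝ (Fin k))⟩ :
        TangentBundle (phaseModel m k) (Cotangent m M × U)) := by
  have h0 : Continuous fun q : Cotangent m M × U =>
      (zeroSection (EuclideanSpace ℝ (Fin m) × (EuclideanSpace ℝ (Fin m) →L[ℝ] ℝ))
        (fun l : Cotangent m M => TangentSpace (cotangentModel m) l) q.1) :=
    (contMDiff_zeroSection ℝ (fun l : Cotangent m M => TangentSpace (cotangentModel m) l)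
      (IB := cotangentModel m) (n := 0)).continuous.comp continuous_fst
  have h1 := (continuous_const_field (U := U) w).comp
    (continuous_snd : Continuous (Prod.snd : Cotangent m M × U → U))
  exact (contMDiff_equivTangentBundleProd_symm (I := cotangentModel m) (M := Cotangent m M)
    (I' := 𝓡 k) (M' := U) (n := 0)).continuous.comp (h0.prodMk h1)

/-- This is the base case of the closedness argument for part 2. -/
lemma isClosed_primarySet {H : Cotangent m M × U → ℝ}
    (hH : ContMDiff (phaseModel m k) 𝓘(ℝ, ℝ) ∞ H) :
    IsClosed (primarySet (phaseModel m k) presymplecticForm H) := by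
  have hcont : ∀ w : EuclideanSpace ℝ (Fin k), Continuous fun q : Cotangent m M × U =>
      (mfderiv (phaseModel m k) 𝓘(ℝ, ℝ) H q ((0, w) : (EuclideanSpace ℝ (Fin m) ×
          (EuclideanSpace ℝ (Fin m) →L[ℝ] ℝ)) × EuclideanSpace ℝ (Fin k)) : ℝ) := fun w =>
    ((contMDiff_snd_tangentBundle_modelSpace ℝ 𝓘(ℝ, ℝ) (n := 0)).continuous.comp
      (hH.contMDiff_tangentMap (m := 0) (by simp)).continuous).comp (continuous_vertical_field w)
  have hset : primarySet (phaseModel m k) presymplecticForm H = ⋂ w : EuclideanSpace ℝ (Fin k),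
      {q | (mfderiv (phaseModel m k) 𝓘(ℝ, ℝ) H q ((0, w) : (EuclideanSpace ℝ (Fin m) ×
          (EuclideanSpace ℝ (Fin m) →L[ℝ] ℝ)) × EuclideanSpace ℝ (Fin k)) : ℝ) = 0} := by
    ext q
    rw [mem_primarySet_iff, mem_iInter]
    rfl
  rw [hset]
  exact isClosed_iInter fun w => isClosed_eq (hcont w) continuous_const

lemma presymplecticForm_self (q : Cotangent m M × U) (v : TangentSpace (phaseModel m k) q) :
    presymplecticForm q v v = 0 :=
  (presymplecticForm_apply q v v).trans (sub_self _)

/-- The projection of an integral curve of a solution field that stays in the primary constraint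
set is a normal extremal. -/
lemma isNormalExtremal_of_integralCurve {X : ∀ p : M × U, TangentSpace (𝓡 m) p.1}
    (hX : ContMDiff ((𝓡 m).prod (𝓡 k)) (𝓡 m).tangent ∞
      (fun p : M × U => (⟨p.1, X p⟩ : TangentBundle (𝓡 m) M)))
    {F : M × U → ℝ} (hF : ContMDiff ((𝓡 m).prod (𝓡 k)) 𝓘(ℝ, ℝ) ∞ F)
    {Z : ∀ q : Cotangent m M × U, TangentSpace (phaseModel m k) q}
    (hZ : Z ∈ hamiltonianFields X F (-1)) {c : ℝ → Cotangent m M × U} {a b : ℝ} (hab : a < b)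
    (hc : IsMIntegralCurveOn (I := phaseModel m k) c Z (Icc a b))
    (hmem : ∀ t ∈ Icc a b, c t ∈ constraintSet X F (-1) 0) :
    IsNormalExtremal X F a b (fun t => projBase (c t)) := by
  have hsol : ∀ t ∈ Icc a b, SolvesAt (phaseModel m k) presymplecticForm (pontryaginH X F (-1))
    (c t) (Z (c t)) := fun t ht => hZ.2 _ (hmem t ht)
  refine ⟨fun t => (c t).1, fun t _ => rfl, hab, hc.continuousOn.fst, ?_, ?_, fun t _ h => ?_⟩
  -- An integral curve of a smooth field is $C^1$ up to the endpoints, so a single piece suffices.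
  · refine ⟨1, fun i => if i = 0 then a else b, by simp, by simp, fun i hi => ?_⟩
    obtain rfl : i = 0 := by omega
    simp only [if_true, zero_add, one_ne_zero, if_false]
    refine ⟨hab, ⟨c, hc.contMDiffOn_Icc hZ.1 hab, fun t _ => rfl⟩, fun t ht => ⟨Z (c t), ?_,
      hsol t (Ioo_subset_Icc_self ht)⟩⟩
    exact (hc t (Ioo_subset_Icc_self ht)).hasMFDerivAt (Icc_mem_nhds ht.1 ht.2)
  · exact hc.eq_of_mfderiv_eq_zero ((contMDiff_pontryaginH hX hF (-1)).mdifferentiable (by simp)) hab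
      fun t ht => (hsol t ht (Z (c t))).symm.trans (presymplecticForm_self _ _)
  · exact absurd (congrArg Prod.fst h) (by norm_num)

end Hamiltonian

/-! ### The proposition -/

theorem propositionc1 {m k : ℕ} {M : Type*} [TopologicalSpace M] [T2Space M]
    [SecondCountableTopology M] [ChartedSpace (EuclideanSpace ℝ (Fin m)) M]
    [IsManifold (𝓡 m) ∞ M] (U : TopologicalSpace.Opens (EuclideanSpace ℝ (Fin k)))
    (X : ∀ p : M × U, TangentSpace (𝓡 m) p.1)
    (hX : ContMDiff ((𝓡 m).prod (𝓡 k)) (𝓡 m).tangent ∞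
      (fun p : M × U => (⟨p.1, X p⟩ : TangentBundle (𝓡 m) M)))
    (F : M × U → ℝ) (hF : ContMDiff ((𝓡 m).prod (𝓡 k)) 𝓘(ℝ, ℝ) ∞ F)
    (hN : ∀ i, IsSubmanifold (phaseModel m k) (constraintSet X F (-1) i))
    (q : Cotangent m M × U) (hq : q ∈ finalConstraintSet X F (-1)) :
    (∃ ε > 0, ∃ c : ℝ → Cotangent m M × U, c 0 = q ∧
      (∀ t ∈ Icc (-ε) ε, c t ∈ finalConstraintSet X F (-1)) ∧
      (∃ Z ∈ hamiltonianFields X F (-1),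
        IsMIntegralCurveOn (I := phaseModel m k) c Z (Icc (-ε) ε)) ∧
      IsNormalExtremal X F (-ε) ε (fun t => projBase (c t))) ∧
    (∀ Z ∈ finalSolutionFields X F (-1),
      ∀ (a b t₀ : ℝ) (c : ℝ → Cotangent m M × U), a < b → t₀ ∈ Icc a b → c t₀ = q →
        IsMIntegralCurveOn (I := phaseModel m k) c Z (Icc a b) →
        (∀ t ∈ Icc a b, c t ∈ finalConstraintSet X F (-1)) ∧
        IsNormalExtremal X F a b (fun t => projBase (c t))) := by
  have hzero : finalConstraintSet X F (-1) ⊆ constraintSet X F (-1) 0 := finalSet_subset 0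
  constructor
  · obtain ⟨i, hi⟩ := exists_eventually_mem_finalSet hN hq
    -- Membership in stage `i + 2` provides a field of stage `i + 1`, hence tangent to stage `i`. No
    -- common field of all stages is needed here.
    obtain ⟨-, Z, hZ, -⟩ := finalSet_subset (i + 2) hq
    have hZs : IsSmoothField (phaseModel m k) Z := IsSmoothField.of_mem_constraintStage hZ
    have hZ0 : Z ∈ hamiltonianFields X F (-1) := constraintStage_snd_antitone (Nat.zero_le _) hZ
    obtain ⟨c, hc0, hc⟩ := exists_isMIntegralCurveAt_of_contMDiffAt_boundaryless 0
      ((hZs q).of_le (by simp))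
    obtain ⟨δ, hδ, hcδ⟩ := isMIntegralCurveAt_iff'.1 hc
    have hsub : ∀ r < δ, Icc (-r) r ⊆ Metric.ball (0 : ℝ) δ := fun r hr t ht => by
      rw [Metric.mem_ball, Real.dist_0_eq_abs]
      exact (abs_le.2 ht).trans_lt hr
    have hhalf := hcδ.mono (hsub (δ / 2) (by linarith))
    have hev := eventually_mem_finalSet_of_integralCurve (hN i) hZs hZ
      (t₀ := 0) ⟨by linarith, by linarith⟩ hhalf (by rw [hc0]; exact hq) (by rw [hc0]; exact hi)
    rw [nhdsWithin_eq_nhds.2 (Icc_mem_nhds (by linarith) (by linarith)),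
      Metric.eventually_nhds_iff] at hev
    obtain ⟨η, hη, hev⟩ := hev
    -- Halving fits the closed interval into the open balls of radii `δ` (existence) and `η`
    -- (staying in the final set).
    have hε : 0 < min (δ / 2) (η / 2) := by positivity
    have hcε := hcδ.mono (hsub (min (δ / 2) (η / 2)) (by linarith [min_le_left (δ / 2) (η / 2)]))
    have hmem : ∀ t ∈ Icc (-min (δ / 2) (η / 2)) (min (δ / 2) (η / 2)),
        c t ∈ finalConstraintSet X F (-1) := fun t ht => hev (by
      rw [Real.dist_0_eq_abs]
      exact (abs_le.2 ht).trans_lt (by linarith [min_le_right (δ / 2) (η / 2)]))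
    exact ⟨_, hε, c, hc0, hmem, ⟨Z, hZ0, hcε⟩, isNormalExtremal_of_integralCurve hX hF hZ0
      (by linarith) hcε fun t ht => hzero (hmem t ht)⟩
  · intro Z hZ a b t₀ c hab ht₀ hc0 hc
    have hmem := forall_mem_finalSet_of_integralCurve hN
      (isClosed_primarySet (contMDiff_pontryaginH hX hF (-1))) hZ ht₀ hc (by rw [hc0]; exact hq)
    exact ⟨hmem, isNormalExtremal_of_integralCurve hX hF (mem_iInter.1 hZ 0) hab hc
      fun t ht => hzero (hmem t ht)⟩
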